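/- Consider contextual bandits with state space $\mathcal S=\{1,\dots,S\}$ and action space $\mathcal A=\{1,\dots,A\}$. A problem is a triple $(\rho,\mu,R)$: a probability distribution $\rho$ on $\mathcal S$, a probability distribution $\mu$ on $\mathcal S\times\mathcal A$, and, for each $(s,a)$, a probability distribution $R(\cdot\mid s,a)$ on $[0,1]$ with mean $r(s,a)$. For a policy $\pi:\mathcal S\to\mathcal A$ let $J(\pi)=\sum_s\rho(s)\,r(s,\pi(s))$. To every problem attach an optimal policy $\pi^\star$, i.e. one with $r(s,\pi^\star(s))=\max_a r(s,a)$ for all $s$ (the choice among optimal policies is arbitrary), and for $C^\star\ge 1$ put $$\mathsf{CB}(C^\star)=\Big\{(\rho,\mu,R)\;:\;\max_{s}\frac{\rho(s)}{\mu(s,\pi^\star(s))}\le C^\star\Big\},$$ with the conventions $0/0=0$ and $x/0=\infty$ for $x>0$. The dataset $\mathcal D=\{(s_i,a_i,r_i)\}_{i=1}^N$ consists of $N$ i.i.d. samples with $(s_i,a_i)\sim\mu$ and $r_i\sim R(\cdot\mid s_i,a_i)$, and an estimator $\hat\pi$ is a measurable map from datasets to policies. There is a universal constant $c>0$ such that for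 all integers $S\ge 2$, $A\ge 2$, $N\ge 1$, every choice of the optimal policies $\pi^\star$, and every real $C^\star\ge 1$, $$\inf_{\hat\pi}\ \sup_{(\rho,\mu,R)\in\mathsf{CB}(C^\star)}\ \mathbb E_{\mathcal D}\big[J(\pi^\star)-J(\hat\pi)\big]\ \ge\ c\,\min\left(1,\ \sqrt{\frac{S(C^\star-1)}{N}}+\frac{S}{N}\right).$$ -/

import Mathlib

open MeasureTheory ProbabilityTheory

namespace OfflineCB

/-- An offline contextual bandit problem with states `Fin S` and actions `Fin A`: the initial state
distribution `ρ`, the behaviour (data) distribution `μ` over state-action pairs, and the family `R`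
of reward distributions on `[0,1]`, one for each state-action pair. -/
structure CBInstance (S A : ℕ) where
  ρ : PMF (Fin S)
  μ : PMF (Fin S × Fin A)
  R : Kernel (Fin S × Fin A) unitInterval
  markovR : IsMarkovKernel R

/-- Deterministic policies. -/
abbrev Policy (S A : ℕ) : Type := Fin S → Fin A

/-- A batch dataset of `N` tuples `((s, a), r)`. -/
abbrev Dataset (S A N : ℕ) : Type := Fin N → (Fin S × Fin A) × unitInterval

namespace CBInstance

variable {S A : ℕ}

/-- The expected reward `r(s,a)`. -/
noncomputable def meanReward (I : CBInstance S A) (s : Fin S) (a : Fin A) : ℝ :=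
  ∫ x : unitInterval, (x : ℝ) ∂(I.R (s, a))

/-- The expected value `J(π) = ∑ₛ ρ(s) r(s, π(s))` of a policy. -/
noncomputable def value (I : CBInstance S A) (π : Policy S A) : ℝ :=
  ∑ s, (I.ρ s).toReal * I.meanReward s (π s)

/-- `π` is an optimal policy: it maximizes the expected reward in every state. -/
def IsOptimal (I : CBInstance S A) (π : Policy S A) : Prop :=
  ∀ s a, I.meanReward s a ≤ I.meanReward s (π s)

/-- The law of one tuple `((s, a), r)`, where `(s, a) ∼ μ` and `r ∼ R(s, a)`. -/
noncomputable def sampleLaw (I : CBInstance S A) : Measure ((Fin S × Fin A) × unitInterval) :=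
  I.μ.toMeasure ⊗ₘ I.R

/-- The law of the dataset: `N` i.i.d. tuples. -/
noncomputable def dataLaw (I : CBInstance S A) (N : ℕ) : Measure (Dataset S A N) :=
  Measure.pi fun _ => I.sampleLaw

/-- The expected sub-optimality `E_D[J(πstar) - J(πhat(D))]` of an estimator `πhat`. -/
noncomputable def expectedSubopt (I : CBInstance S A) (πstar : Policy S A) {N : ℕ}
    (πhat : Dataset S A N → Policy S A) : ℝ :=
  ∫ D, (I.value πstar - I.value (πhat D)) ∂(I.dataLaw N)

end CBInstance

/-- The family `CB(C)` of problems with `max_s ρ(s) / μ(s, π⋆(s)) ≤ C`, where `πstar I` is the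
optimal policy attached to the problem `I`. The quotients are taken in `[0,∞]`, where `0 / 0 = 0`
and `x / 0 = ∞` for `x > 0`. -/
def CB {S A : ℕ} (πstar : CBInstance S A → Policy S A) (C : ℝ) : Set (CBInstance S A) :=
  {I | ⨆ s, I.ρ s / I.μ (s, πstar I s) ≤ ENNReal.ofReal C}

/-- The worst-case risk of an estimator over `CB(C)` (supremum in the extended reals). -/
noncomputable def worstCaseRisk {S A N : ℕ} (πstar : CBInstance S A → Policy S A) (C : ℝ)
    (πhat : Dataset S A N → Policy S A) : EReal :=
  ⨆ I ∈ CB πstar C, (I.expectedSubopt (πstar I) πhat : EReal)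

/-- The minimax risk over `CB(C)` with `N` samples: the infimum of the worst-case risk over all
estimators, i.e. all measurable maps from datasets to policies. -/
noncomputable def minimaxRisk {S A : ℕ} (πstar : CBInstance S A → Policy S A) (C : ℝ)
    (N : ℕ) : EReal :=
  ⨅ (πhat : Dataset S A N → Policy S A) (_ : Measurable πhat), worstCaseRisk πstar C πhat

end OfflineCB

namespace OfflineCB

/-! Both terms come from Assouad's lemma. Bernoulli problems are indexed by bit vectors, one bit for
each of the `T = S - 1` hard states of equal probability `p`; the first state absorbs the remaining
probability. If flipping a bit keeps the Bhattacharyya coefficient of one sample at least `1 -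
1/(2N)`, the datasets have affinity at least 1/8, so for some bit vector every estimator pays a
constant fraction of the total separation (`le_minimaxRisk_of_flipBit`).

Term `S/N` (`le_minimaxRisk_expert`): the data show optimal actions only, so `C = 1` is allowed, and
a bit is revealed only when its state is visited. With `p` of order `1/(N + S)` many states stay
unseen.

Square root term (`le_minimaxRisk_bandit`): action 0 has mean 1/2 and action 1 has mean 1/2 ± δ.
Coverage lets `μ` give action 1 only `p / C`, so gaps with `(p / C) δ²` of order `1/N` go
undetected, at a cost of order `T p δ`.

The first family serves when `C - 1 ≤ S/N`, the second otherwise. -/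

/-! ### Affinity of product laws and Assouad's lemma -/

/-- The affinity `∑ min (P, Q)` of two mass functions is at least half of their squared
Bhattacharyya coefficient. -/
theorem sq_sum_sqrt_le_two_mul_sum_min {X : Type*} [Fintype X] {P Q : X → ℝ}
    (hP : ∀ x, 0 ≤ P x) (hQ : ∀ x, 0 ≤ Q x) (hP1 : ∑ x, P x = 1) (hQ1 : ∑ x, Q x = 1) :
    (∑ x, √(P x * Q x)) ^ 2 ≤ 2 * ∑ x, min (P x) (Q x) := by
  -- Cauchy–Schwarz applied to √(PQ) = √min · √max, together with ∑ max ≤ 2.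
  have h1 : ∀ x, √(P x * Q x) = √(min (P x) (Q x)) * √(max (P x) (Q x)) := fun x => by
    rw [← Real.sqrt_mul (le_min (hP x) (hQ x)), min_mul_max]
  have h2 := Finset.sum_mul_sq_le_sq_mul_sq Finset.univ
    (fun x => √(min (P x) (Q x))) (fun x => √(max (P x) (Q x)))
  simp only [← h1] at h2
  have h3 : ∀ x, √(min (P x) (Q x)) ^ 2 = min (P x) (Q x) := fun x =>
    Real.sq_sqrt (le_min (hP x) (hQ x))
  have h4 : ∀ x, √(max (P x) (Q x)) ^ 2 = max (P x) (Q x) := fun x =>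
    Real.sq_sqrt ((hP x).trans (le_max_left _ _))
  simp only [h3, h4] at h2
  have h5 : ∑ x, max (P x) (Q x) ≤ 2 := by
    calc ∑ x, max (P x) (Q x) ≤ ∑ x, (P x + Q x) :=
          Finset.sum_le_sum fun x _ => max_le_add_of_nonneg (hP x) (hQ x)
      _ = 2 := by rw [Finset.sum_add_distrib, hP1, hQ1]; norm_num
  have h6 : 0 ≤ ∑ x, min (P x) (Q x) := Finset.sum_nonneg fun x _ => le_min (hP x) (hQ x)
  nlinarith

/-- The `N`-fold products of two mass functions whose Bhattacharyya coefficient is at least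
`1 - 1 / (2 N)` have affinity at least `1 / 8`. -/
theorem one_eighth_le_sum_min_prod {X : Type*} [Fintype X] {P Q : X → ℝ} {N : ℕ} (hN : 1 ≤ N)
    (hP : ∀ x, 0 ≤ P x) (hQ : ∀ x, 0 ≤ Q x) (hP1 : ∑ x, P x = 1) (hQ1 : ∑ x, Q x = 1)
    (h : 1 - 1 / (2 * (N : ℝ)) ≤ ∑ x, √(P x * Q x)) :
    1 / 8 ≤ ∑ D : Fin N → X, min (∏ i, P (D i)) (∏ i, Q (D i)) := by
  classical
  have hN' : (1 : ℝ) ≤ N := by exact_mod_cast hN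
  have key := sq_sum_sqrt_le_two_mul_sum_min (P := fun D : Fin N → X => ∏ i, P (D i))
    (Q := fun D : Fin N → X => ∏ i, Q (D i)) (fun D => Finset.prod_nonneg fun i _ => hP _)
    (fun D => Finset.prod_nonneg fun i _ => hQ _) (by rw [← Fintype.sum_pow, hP1, one_pow])
    (by rw [← Fintype.sum_pow, hQ1, one_pow])
  have h1 : ∀ D : Fin N → X,
      √((∏ i, P (D i)) * ∏ i, Q (D i)) = ∏ i, √(P (D i) * Q (D i)) := fun D => by
    rw [← Finset.prod_mul_distrib, Real.sqrt_prod _ fun i _ => mul_nonneg (hP _) (hQ _)]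
  simp only [h1] at key
  rw [← Fintype.sum_pow (fun x => √(P x * Q x))] at key
  have hinv : 1 / (2 * (N : ℝ)) ≤ 1 / 2 := by
    apply one_div_le_one_div_of_le <;> linarith
  -- The coefficient of the products is the `N`-th power, at least 1/2 by Bernoulli's inequality.
  -- Hence 1/4 ≤ 2 · affinity.
  have h2 : (1 : ℝ) / 2 ≤ (∑ x, √(P x * Q x)) ^ N := by
    calc (1 : ℝ) / 2 = 1 + N * (-(1 / (2 * (N : ℝ)))) := by field_simp; norm_num
      _ ≤ (1 + -(1 / (2 * (N : ℝ)))) ^ N := one_add_mul_le_pow (by linarith) N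
      _ ≤ _ := by
        apply pow_le_pow_left₀ <;> linarith
  nlinarith

/-- Flip the `i`-th bit of `θ`. -/
def flipBit {ι : Type*} [DecidableEq ι] (i : ι) (θ : ι → Bool) : ι → Bool :=
  Function.update θ i (!θ i)

theorem flipBit_involutive {ι : Type*} [DecidableEq ι] (i : ι) :
    Function.Involutive (flipBit i) := by
  intro θ
  simp [flipBit]

theorem flipBit_self {ι : Type*} [DecidableEq ι] (i : ι) (θ : ι → Bool) :
    flipBit i θ i = !θ i := by
  simp [flipBit]

theorem flipBit_of_ne {ι : Type*} [DecidableEq ι] {i j : ι} (h : j ≠ i) (θ : ι → Bool) :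
    flipBit i θ j = θ j := by
  simp [flipBit, h]

/-- Assouad's lemma for mass functions on a finite set. -/
theorem exists_le_sum_mul_of_flipBit {ι X : Type*} [Fintype ι] [DecidableEq ι] [Fintype X]
    {P : (ι → Bool) → X → ℝ} {L : (ι → Bool) → ι → X → ℝ} {Δ η : ℝ}
    (hP : ∀ θ x, 0 ≤ P θ x) (hL : ∀ θ i x, 0 ≤ L θ i x) (hΔ : 0 ≤ Δ)
    (hsep : ∀ θ i x, Δ ≤ L θ i x + L (flipBit i θ) i x)
    (hη : ∀ θ i, η ≤ ∑ x, min (P θ x) (P (flipBit i θ) x)) :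
    ∃ θ, Fintype.card ι * (Δ * η / 2) ≤ ∑ x, P θ x * ∑ i, L θ i x := by
  have hpair : ∀ θ i, Δ * η ≤
      ∑ x, P θ x * L θ i x + ∑ x, P (flipBit i θ) x * L (flipBit i θ) i x := by
    intro θ i
    rw [← Finset.sum_add_distrib]
    calc Δ * η ≤ Δ * ∑ x, min (P θ x) (P (flipBit i θ) x) :=
          mul_le_mul_of_nonneg_left (hη θ i) hΔ
      _ = ∑ x, Δ * min (P θ x) (P (flipBit i θ) x) := Finset.mul_sum _ _ _
      _ ≤ _ := Finset.sum_le_sum fun x _ => by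
        have h0 : 0 ≤ min (P θ x) (P (flipBit i θ) x) := le_min (hP _ _) (hP _ _)
        nlinarith [mul_le_mul_of_nonneg_right (hsep θ i x) h0,
          mul_le_mul_of_nonneg_right (min_le_left (P θ x) (P (flipBit i θ) x)) (hL θ i x),
          mul_le_mul_of_nonneg_right (min_le_right (P θ x) (P (flipBit i θ) x))
            (hL (flipBit i θ) i x)]
  -- Flipping a bit permutes the bit vectors, so summing `hpair` over `θ` counts each loss twice.
  have havg : ∀ i, ∑ _θ : ι → Bool, Δ * η / 2 ≤ ∑ θ, ∑ x, P θ x * L θ i x := by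
    intro i
    have h1 : ∑ θ, ∑ x, P (flipBit i θ) x * L (flipBit i θ) i x = ∑ θ, ∑ x, P θ x * L θ i x :=
      Equiv.sum_comp (flipBit_involutive i).toPerm fun θ => ∑ x, P θ x * L θ i x
    have h2 : ∑ _θ : ι → Bool, Δ * η ≤ ∑ θ, _ := Finset.sum_le_sum fun θ _ => hpair θ i
    rw [Finset.sum_add_distrib, h1] at h2
    rw [← Finset.sum_div]
    linarith
  obtain ⟨θ, -, hθ⟩ := Finset.exists_le_of_sum_le (s := Finset.univ)
    (f := fun _ : ι → Bool => Fintype.card ι * (Δ * η / 2))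
    (g := fun θ => ∑ x, P θ x * ∑ i, L θ i x) Finset.univ_nonempty (by
      have h3 : ∑ _i : ι, ∑ _θ : ι → Bool, Δ * η / 2 ≤ ∑ i, ∑ θ, ∑ x, P θ x * L θ i x :=
        Finset.sum_le_sum fun i _ => havg i
      rw [Finset.sum_comm] at h3
      have h4 : ∑ θ, ∑ x, P θ x * ∑ i, L θ i x = ∑ i, ∑ θ, ∑ x, P θ x * L θ i x := by
        rw [Finset.sum_comm (f := fun i θ => ∑ x, P θ x * L θ i x)]
        refine Finset.sum_congr rfl fun θ _ => ?_
        simp_rw [Finset.mul_sum]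
        exact Finset.sum_comm
      rw [h4]
      simpa using h3)
  exact ⟨θ, hθ⟩

/-! ### Bernoulli problems and the law of their data -/

/-- The mass function of the Bernoulli law with mean `r`. -/
def bernoulliWeight (r : ℝ) (b : Bool) : ℝ := if b then r else 1 - r

theorem bernoulliWeight_nonneg {r : ℝ} (hr : r ∈ Set.Icc (0 : ℝ) 1) (b : Bool) :
    0 ≤ bernoulliWeight r b := by
  cases b
  · simpa [bernoulliWeight] using hr.2
  · simpa [bernoulliWeight] using hr.1

/-- The reward encoded by a bit. -/
def bitReward (b : Bool) : unitInterval := if b then 1 else 0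

/-- The problem with Bernoulli rewards of means `r`. -/
noncomputable def bernoulliInstance {S A : ℕ} (ρ : PMF (Fin S)) (μ : PMF (Fin S × Fin A))
    (r : Fin S × Fin A → ℝ) (hr : ∀ x, r x ∈ Set.Icc (0 : ℝ) 1) : CBInstance S A where
  ρ := ρ
  μ := μ
  R := Kernel.ofFunOfCountable fun x =>
    ∑ b, ENNReal.ofReal (bernoulliWeight (r x) b) • Measure.dirac (bitReward b)
  markovR := ⟨fun x => ⟨by
    have h := hr x
    simp only [Kernel.ofFunOfCountable, Kernel.coe_mk, Fintype.sum_bool, Measure.add_apply,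
      Measure.smul_apply, measure_univ, smul_eq_mul, mul_one]
    rw [← ENNReal.ofReal_add (bernoulliWeight_nonneg h _) (bernoulliWeight_nonneg h _)]
    simp [bernoulliWeight]⟩⟩

section bernoulliInstance

variable {S A : ℕ} (ρ : PMF (Fin S)) (μ : PMF (Fin S × Fin A)) (r : Fin S × Fin A → ℝ)
  (hr : ∀ x, r x ∈ Set.Icc (0 : ℝ) 1)

theorem bernoulliInstance_R_apply (x : Fin S × Fin A) :
    (bernoulliInstance ρ μ r hr).R x =
      ∑ b, ENNReal.ofReal (bernoulliWeight (r x) b) • Measure.dirac (bitReward b) := rfl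

theorem meanReward_bernoulliInstance (s : Fin S) (a : Fin A) :
    (bernoulliInstance ρ μ r hr).meanReward s a = r (s, a) := by
  have h := hr (s, a)
  rw [CBInstance.meanReward, bernoulliInstance_R_apply, Fintype.sum_bool,
    integral_add_measure, integral_smul_measure, integral_smul_measure, integral_dirac,
    integral_dirac]
  · simp [bitReward, bernoulliWeight, h.1]
  all_goals exact (integrable_dirac (by simp)).smul_measure ENNReal.ofReal_ne_top

/-- The mass function of one observation of a Bernoulli problem. -/
noncomputable def sampleWeight (μ : PMF (Fin S × Fin A)) (r : Fin S × Fin A → ℝ)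
    (y : (Fin S × Fin A) × Bool) : ℝ :=
  (μ y.1).toReal * bernoulliWeight (r y.1) y.2

/-- The observation encoded by a state-action pair and a bit. -/
def bitSample (y : (Fin S × Fin A) × Bool) : (Fin S × Fin A) × unitInterval :=
  (y.1, bitReward y.2)

theorem sampleWeight_nonneg (hr : ∀ x, r x ∈ Set.Icc (0 : ℝ) 1) (y : (Fin S × Fin A) × Bool) : 0 ≤ sampleWeight μ r y :=
  mul_nonneg ENNReal.toReal_nonneg (bernoulliWeight_nonneg (hr _) _)

theorem sum_toReal_pmf {X : Type*} [Fintype X] (P : PMF X) : ∑ x, (P x).toReal = 1 := by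
  rw [← ENNReal.toReal_sum fun x _ => P.apply_ne_top x, ← tsum_fintype (L := .unconditional X),
    P.tsum_coe, ENNReal.toReal_one]

theorem sum_sampleWeight : ∑ y, sampleWeight μ r y = 1 := by
  rw [Fintype.sum_prod_type, ← sum_toReal_pmf μ]
  refine Finset.sum_congr rfl fun x _ => ?_
  simp [sampleWeight, bernoulliWeight]
  ring

/-- The finitely supported law on encoded observations. -/
noncomputable def bitLaw (μ : PMF (Fin S × Fin A)) (r : Fin S × Fin A → ℝ) :
    Measure ((Fin S × Fin A) × Bool) :=
  ∑ y, ENNReal.ofReal (sampleWeight μ r y) • Measure.dirac y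

theorem bitLaw_singleton (y : (Fin S × Fin A) × Bool) :
    bitLaw μ r {y} = ENNReal.ofReal (sampleWeight μ r y) := by
  classical
  simp [bitLaw, Measure.finsetSum_apply, Set.indicator_apply]

theorem isProbabilityMeasure_bitLaw (hr : ∀ x, r x ∈ Set.Icc (0 : ℝ) 1) :
    IsProbabilityMeasure (bitLaw μ r) := ⟨by
  simp only [bitLaw, Measure.finsetSum_apply, Measure.smul_apply, measure_univ, smul_eq_mul,
    mul_one]
  rw [← ENNReal.ofReal_sum_of_nonneg fun y _ => sampleWeight_nonneg μ r hr y, sum_sampleWeight,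
    ENNReal.ofReal_one]⟩

/-- Coding rewards by bits moves the data to a finite space, where expectations are finite sums and
Assouad's lemma applies. -/
theorem sampleLaw_bernoulliInstance :
    (bernoulliInstance ρ μ r hr).sampleLaw = (bitLaw μ r).map bitSample := by
  have := (bernoulliInstance ρ μ r hr).markovR
  ext s hs
  rw [CBInstance.sampleLaw, Measure.compProd_apply hs, lintegral_fintype,
    Measure.map_apply (measurable_of_finite _) hs]
  simp only [bitLaw, bernoulliInstance_R_apply, Measure.finsetSum_apply, Measure.smul_apply,
    smul_eq_mul]
  rw [Fintype.sum_prod_type (α₁ := Fin S × Fin A)]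
  refine Finset.sum_congr rfl fun x _ => ?_
  rw [Finset.sum_mul]
  refine Finset.sum_congr rfl fun b _ => ?_
  rw [PMF.toMeasure_apply_singleton _ _ (measurableSet_singleton x),
    Measure.dirac_apply' _ (measurable_prodMk_left hs),
    Measure.dirac_apply' _ (measurable_of_finite bitSample hs), sampleWeight,
    ENNReal.ofReal_mul ENNReal.toReal_nonneg, ENNReal.ofReal_toReal (μ.apply_ne_top _)]
  change _ * (μ x) = _
  rw [mul_comm, mul_assoc]
  rfl

theorem integral_dataLaw_bernoulliInstance {N : ℕ} {f : Dataset S A N → ℝ} (hf : Measurable f) :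
    ∫ D, f D ∂((bernoulliInstance ρ μ r hr).dataLaw N) =
      ∑ D : Fin N → (Fin S × Fin A) × Bool,
        (∏ i, sampleWeight μ r (D i)) * f fun i => bitSample (D i) := by
  have := isProbabilityMeasure_bitLaw μ r hr
  have hm : Measurable (bitSample : (Fin S × Fin A) × Bool → _) := measurable_of_finite _
  have := Measure.isProbabilityMeasure_map (μ := bitLaw μ r) hm.aemeasurable
  rw [CBInstance.dataLaw, sampleLaw_bernoulliInstance,
    ← Measure.pi_map_pi (μ := fun _ : Fin N => bitLaw μ r) fun _ => hm.aemeasurable,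
    integral_map (measurable_of_finite _).aemeasurable hf.aestronglyMeasurable, integral_fintype .of_finite]
  refine Finset.sum_congr rfl fun D _ => ?_
  rw [Measure.real, Measure.pi_singleton, ENNReal.toReal_prod, smul_eq_mul]
  simp only [bitLaw_singleton, ENNReal.toReal_ofReal (sampleWeight_nonneg μ r hr _)]

end bernoulliInstance

/-! ### From bit flips to the minimax risk -/

/-- Assouad's bound for a family of Bernoulli problems indexed by bit vectors. -/
theorem le_minimaxRisk_of_flipBit {T A N : ℕ} (hN : 1 ≤ N)
    {πstar : CBInstance (T + 1) A → Policy (T + 1) A} (hopt : ∀ I, CBInstance.IsOptimal I (πstar I)) {C : ℝ}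
    (ρ : PMF (Fin (T + 1))) (μ : (Fin T → Bool) → PMF (Fin (T + 1) × Fin A))
    (r : (Fin T → Bool) → Fin (T + 1) × Fin A → ℝ) (hr : ∀ θ x, r θ x ∈ Set.Icc (0 : ℝ) 1)
    (best : (Fin T → Bool) → Policy (T + 1) A)
    (hbest : ∀ θ s a, a ≠ best θ s → r θ (s, a) < r θ (s, best θ s))
    (hC : ∀ θ s, ρ s ≤ μ θ (s, best θ s) * ENNReal.ofReal C) {p Δ : ℝ} (hp : 0 ≤ p) (hΔ : 0 ≤ Δ)
    (hρ : ∀ i : Fin T, p ≤ (ρ i.succ).toReal)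
    (hsep : ∀ θ i a, Δ ≤ (r θ (i.succ, best θ i.succ) - r θ (i.succ, a)) +
      (r (flipBit i θ) (i.succ, best (flipBit i θ) i.succ) - r (flipBit i θ) (i.succ, a)))
    (hbc : ∀ θ i, 1 - 1 / (2 * (N : ℝ)) ≤
      ∑ y, √(sampleWeight (μ θ) (r θ) y * sampleWeight (μ (flipBit i θ)) (r (flipBit i θ)) y)) :
    ((T * p * Δ / 16 : ℝ) : EReal) ≤ minimaxRisk πstar C N := by
  have hle : ∀ θ s a, r θ (s, a) ≤ r θ (s, best θ s) := fun θ s a => by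
    rcases eq_or_ne a (best θ s) with rfl | h
    exacts [le_rfl, (hbest θ s a h).le]
  -- Strict optimality leaves a single optimal policy, so the arbitrary choice `πstar` has no
  -- freedom here.
  have hstar : ∀ θ, πstar (bernoulliInstance ρ (μ θ) (r θ) (hr θ)) = best θ := by
    intro θ
    funext s
    by_contra h
    have h1 := hopt (bernoulliInstance ρ (μ θ) (r θ) (hr θ)) s (best θ s)
    rw [meanReward_bernoulliInstance, meanReward_bernoulliInstance] at h1
    exact (hbest θ s _ h).not_ge h1
  refine le_iInf₂ fun πhat hπ => ?_
  obtain ⟨θ, hθ⟩ := exists_le_sum_mul_of_flipBit (ι := Fin T)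
    (X := Fin N → (Fin (T + 1) × Fin A) × Bool)
    (P := fun θ D => ∏ i, sampleWeight (μ θ) (r θ) (D i))
    (L := fun θ i D => p * (r θ (i.succ, best θ i.succ) -
      r θ (i.succ, πhat (fun j => bitSample (D j)) i.succ))) (Δ := p * Δ) (η := 1 / 8)
    (fun θ D => Finset.prod_nonneg fun i _ => sampleWeight_nonneg _ _ (hr θ) _)
    (fun θ i D => mul_nonneg hp (sub_nonneg.2 (hle _ _ _))) (mul_nonneg hp hΔ)
    (fun θ i D => by rw [← mul_add]; exact mul_le_mul_of_nonneg_left (hsep θ i _) hp)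
    (fun θ i => one_eighth_le_sum_min_prod hN (sampleWeight_nonneg _ _ (hr _))
      (sampleWeight_nonneg _ _ (hr _)) (sum_sampleWeight _ _) (sum_sampleWeight _ _) (hbc θ i))
  set I := bernoulliInstance ρ (μ θ) (r θ) (hr θ) with hI
  have hmem : I ∈ CB πstar C := by
    refine iSup_le fun s => ENNReal.div_le_of_le_mul' ?_
    rw [hstar θ]
    exact hC θ s
  refine le_trans ?_ (le_iSup₂_of_le I hmem le_rfl)
  rw [EReal.coe_le_coe_iff, CBInstance.expectedSubopt, hstar θ]
  refine le_of_le_of_eq ?_ (integral_dataLaw_bernoulliInstance ρ (μ θ) (r θ) (hr θ)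
    ((measurable_of_finite fun π => I.value (best θ) - I.value π).comp hπ)).symm
  have h16 : (T : ℝ) * p * Δ / 16 = Fintype.card (Fin T) * (p * Δ * (1 / 8) / 2) := by
    rw [Fintype.card_fin]; ring
  rw [h16]
  refine hθ.trans (Finset.sum_le_sum fun D _ => mul_le_mul_of_nonneg_left ?_
    (Finset.prod_nonneg fun i _ => sampleWeight_nonneg _ _ (hr θ) _))
  simp only [Function.comp_apply, CBInstance.value, hI, meanReward_bernoulliInstance]
  -- The first state carries no bit; its nonnegative regret is dropped.
  rw [← Finset.sum_sub_distrib, Fin.sum_univ_succ]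
  simp only [← mul_sub]
  refine (Finset.sum_le_sum fun i _ => mul_le_mul_of_nonneg_right (hρ i)
    (sub_nonneg.2 (hle _ _ _))).trans (le_add_of_nonneg_left
      (mul_nonneg ENNReal.toReal_nonneg (sub_nonneg.2 (hle _ _ _))))

/-- A pointwise lower bound on the Bhattacharyya coefficient of two Bernoulli problems. -/
theorem one_sub_le_sum_sqrt_sampleWeight {S A : ℕ} (μ μ' : PMF (Fin S × Fin A))
    (r r' ε : Fin S × Fin A → ℝ)
    (h : ∀ x, (μ x).toReal * (1 - ε x) ≤ √((μ x).toReal * (μ' x).toReal) *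
      ∑ b, √(bernoulliWeight (r x) b * bernoulliWeight (r' x) b)) :
    1 - ∑ x, (μ x).toReal * ε x ≤ ∑ y, √(sampleWeight μ r y * sampleWeight μ' r' y) := by
  rw [Fintype.sum_prod_type (α₁ := Fin S × Fin A), ← sum_toReal_pmf μ, ← Finset.sum_sub_distrib]
  refine Finset.sum_le_sum fun x _ => ?_
  have h1 : (μ x).toReal - (μ x).toReal * ε x = (μ x).toReal * (1 - ε x) := by ring
  rw [h1]
  refine (h x).trans_eq ?_
  rw [Finset.mul_sum]
  refine Finset.sum_congr rfl fun b _ => ?_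
  rw [← Real.sqrt_mul (mul_nonneg ENNReal.toReal_nonneg ENNReal.toReal_nonneg)]
  congr 1
  simp only [sampleWeight]
  ring

theorem sum_sqrt_bernoulliWeight_self {r : ℝ} (hr : r ∈ Set.Icc (0 : ℝ) 1) :
    ∑ b, √(bernoulliWeight r b * bernoulliWeight r b) = 1 := by
  simp only [Real.sqrt_mul_self (bernoulliWeight_nonneg hr _)]
  simp [bernoulliWeight]

/-! ### Expert data -/

/-- The probability mass function with the given real weights. -/
noncomputable def pmfOfReal {X : Type*} [Fintype X] (f : X → ℝ) (h0 : ∀ x, 0 ≤ f x)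
    (h1 : ∑ x, f x = 1) : PMF X :=
  PMF.ofFintype (fun x => ENNReal.ofReal (f x)) (by
    rw [← ENNReal.ofReal_sum_of_nonneg fun x _ => h0 x, h1, ENNReal.ofReal_one])

theorem pmfOfReal_apply {X : Type*} [Fintype X] {f : X → ℝ} (h0 : ∀ x, 0 ≤ f x)
    (h1 : ∑ x, f x = 1) (x : X) : pmfOfReal f h0 h1 x = ENNReal.ofReal (f x) := rfl

theorem toReal_pmfOfReal_apply {X : Type*} [Fintype X] {f : X → ℝ} (h0 : ∀ x, 0 ≤ f x)
    (h1 : ∑ x, f x = 1) (x : X) : (pmfOfReal f h0 h1 x).toReal = f x := by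
  rw [pmfOfReal_apply, ENNReal.toReal_ofReal (h0 x)]

/-- Weight `p` on every state but the first, and the remaining weight on the first state. -/
def stateWeight (T : ℕ) (p : ℝ) : Fin (T + 1) → ℝ := Fin.cons (1 - T * p) fun _ => p

theorem stateWeight_nonneg {T : ℕ} {p : ℝ} (hp : 0 ≤ p) (hTp : T * p ≤ 1) (s : Fin (T + 1)) :
    0 ≤ stateWeight T p s := by
  cases s using Fin.cases with
  | zero => simpa [stateWeight] using hTp
  | succ i => simpa [stateWeight] using hp

theorem sum_stateWeight (T : ℕ) (p : ℝ) : ∑ s, stateWeight T p s = 1 := by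
  simp [stateWeight, Fin.sum_univ_succ]

/-- The policy that plays `0` in the first state and the bits of `θ` in the other ones. -/
def bitPolicy {T : ℕ} (B : ℕ) (θ : Fin T → Bool) : Policy (T + 1) (B + 2) :=
  Fin.cons 0 fun i => if θ i then 1 else 0

/-- The lower bound from expert data: rarely visited states are not seen. -/
theorem le_minimaxRisk_expert {T B N : ℕ} (hN : 1 ≤ N)
    {πstar : CBInstance (T + 1) (B + 2) → Policy (T + 1) (B + 2)}
    (hopt : ∀ I, CBInstance.IsOptimal I (πstar I)) {C : ℝ} (hC : 1 ≤ C) {p : ℝ} (hp : 0 ≤ p)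
    (hTp : T * p ≤ 1) (hNp : p ≤ 1 / (2 * (N : ℝ))) :
    ((T * p / 16 : ℝ) : EReal) ≤ minimaxRisk πstar C N := by
  have hs := stateWeight_nonneg hp hTp
  have h0 : ∀ (θ : Fin T → Bool) (x : Fin (T + 1) × Fin (B + 2)),
      0 ≤ if x.2 = bitPolicy B θ x.1 then stateWeight T p x.1 else 0 := fun θ x => by
    split_ifs
    exacts [hs _, le_rfl]
  have h1 : ∀ θ : Fin T → Bool, ∑ x : Fin (T + 1) × Fin (B + 2),
      (if x.2 = bitPolicy B θ x.1 then stateWeight T p x.1 else 0) = 1 := fun θ => by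
    rw [Fintype.sum_prod_type, ← sum_stateWeight T p]
    simp
  have hr : ∀ (θ : Fin T → Bool) (x : Fin (T + 1) × Fin (B + 2)),
      (if x.2 = bitPolicy B θ x.1 then (1 : ℝ) else 0) ∈ Set.Icc (0 : ℝ) 1 := fun θ x => by
    split_ifs <;> simp
  have key := le_minimaxRisk_of_flipBit hN hopt (C := C) (pmfOfReal _ hs (sum_stateWeight T p))
    (fun θ => pmfOfReal _ (h0 θ) (h1 θ)) _ hr (bitPolicy B) (fun θ s a h => by simp [h])
    (fun θ s => ?_) hp zero_le_one (fun i => ?_) (fun θ i a => ?_) (fun θ i => ?_)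
  · simpa using key
  · simp only [pmfOfReal_apply, if_true]
    exact le_mul_of_one_le_right zero_le (by simpa using hC)
  · rw [toReal_pmfOfReal_apply]
    simp [stateWeight]
  -- The optimal actions under the two bits differ, so every action loses 1 under at least one of
  -- them.
  · have hne : bitPolicy B θ i.succ ≠ bitPolicy B (flipBit i θ) i.succ := by
      cases h : θ i <;> simp [bitPolicy, flipBit_self, h]
    by_cases ha : a = bitPolicy B θ i.succ
    · have hb : a ≠ bitPolicy B (flipBit i θ) i.succ := ha ▸ hne
      simp [← ha, hb]
    · simp only [if_true, if_neg ha]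
      split_ifs <;> norm_num
  -- The two laws agree off state `i.succ`, whose whole mass `p` is given up.
  · refine le_trans ?_ (one_sub_le_sum_sqrt_sampleWeight _ _ _ _
      (fun x => if x.1 = i.succ then 1 else 0) fun x => ?_)
    · have : ∑ x : Fin (T + 1) × Fin (B + 2), (pmfOfReal _ (h0 θ) (h1 θ) x).toReal *
          (if x.1 = i.succ then (1 : ℝ) else 0) = p := by
        simp only [toReal_pmfOfReal_apply]
        rw [Fintype.sum_prod_type]
        simp [stateWeight]
      rw [this]
      linarith
    · by_cases hx : x.1 = i.succ
      · simp only [hx, if_true, sub_self, mul_zero]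
        positivity
      · have hpol : bitPolicy B (flipBit i θ) x.1 = bitPolicy B θ x.1 := by
          obtain ⟨s, a⟩ := x
          cases s using Fin.cases with
          | zero => rfl
          | succ j =>
            have hj : j ≠ i := fun h => hx (by simp [h])
            simp [bitPolicy, flipBit_of_ne hj]
        simp only [toReal_pmfOfReal_apply, hpol]
        rw [sum_sqrt_bernoulliWeight_self (hr θ x), Real.sqrt_mul_self (h0 θ x), if_neg hx, sub_zero]

/-! ### Bandit data with a small gap -/

/-- The data weights of the bandit problems: in the first state only action `0` is observed, with
weight `q`; in the other states action `0` has weight `u` and action `1` weight `v`. -/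
def banditWeight (T B : ℕ) (q u v : ℝ) (x : Fin (T + 1) × Fin (B + 2)) : ℝ :=
  if x.2 = 0 then (Fin.cons q (fun _ => u) : Fin (T + 1) → ℝ) x.1
  else if x.2 = 1 then (Fin.cons 0 (fun _ => v) : Fin (T + 1) → ℝ) x.1 else 0

theorem banditWeight_nonneg {T B : ℕ} {q u v : ℝ} (hq : 0 ≤ q) (hu : 0 ≤ u) (hv : 0 ≤ v)
    (x : Fin (T + 1) × Fin (B + 2)) : 0 ≤ banditWeight T B q u v x := by
  obtain ⟨s, a⟩ := x
  cases s using Fin.cases <;> simp only [banditWeight, Fin.cons_zero, Fin.cons_succ] <;>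
    split_ifs <;> first | assumption | exact le_rfl

theorem sum_banditWeight (T B : ℕ) (q u v : ℝ) :
    ∑ x, banditWeight T B q u v x = q + T * (u + v) := by
  have h : ∀ s : Fin (T + 1), ∑ a, banditWeight T B q u v (s, a) =
      (Fin.cons q (fun _ => u + v) : Fin (T + 1) → ℝ) s := fun s => by
    rw [Fin.sum_univ_succ, Fin.sum_univ_succ, Finset.sum_eq_zero]
    · cases s using Fin.cases <;> simp [banditWeight]
    · intro a _
      have h1 : a.succ.succ ≠ (1 : Fin (B + 2)) := fun h => by
        simpa using Fin.succ_injective _ (h.trans Fin.succ_zero_eq_one.symm)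
      simp [banditWeight, h1]
  rw [Fintype.sum_prod_type]
  simp only [h, Fin.sum_univ_succ, Fin.cons_zero, Fin.cons_succ, Finset.sum_const,
    Finset.card_univ, Fintype.card_fin, nsmul_eq_mul]

/-- The mean rewards of the bandit problems: in the states other than the first one, action `0` has
mean `1 / 2` and action `1` has mean `1 / 2 ± δ`, with the sign given by the bits of `θ`. -/
noncomputable def banditMean {T : ℕ} (B : ℕ) (δ : ℝ) (θ : Fin T → Bool)
    (x : Fin (T + 1) × Fin (B + 2)) : ℝ :=
  if x.2 = 0 then (Fin.cons 1 (fun _ => 1 / 2) : Fin (T + 1) → ℝ) x.1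
  else if x.2 = 1 then
    (Fin.cons 0 (fun i => if θ i then 1 / 2 + δ else 1 / 2 - δ) : Fin (T + 1) → ℝ) x.1
  else 0

theorem banditMean_mem_Icc {T B : ℕ} {δ : ℝ} (h0 : 0 ≤ δ) (h1 : δ ≤ 1 / 2) (θ : Fin T → Bool)
    (x : Fin (T + 1) × Fin (B + 2)) : banditMean B δ θ x ∈ Set.Icc (0 : ℝ) 1 := by
  obtain ⟨s, a⟩ := x
  cases s using Fin.cases <;> simp only [banditMean, Fin.cons_zero, Fin.cons_succ] <;>
    split_ifs <;> constructor <;> linarith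

theorem banditMean_lt_bitPolicy {T B : ℕ} {δ : ℝ} (h0 : 0 < δ) (h1 : δ ≤ 1 / 2)
    (θ : Fin T → Bool) (s : Fin (T + 1)) (a : Fin (B + 2)) (ha : a ≠ bitPolicy B θ s) :
    banditMean B δ θ (s, a) < banditMean B δ θ (s, bitPolicy B θ s) := by
  cases s using Fin.cases with
  | zero =>
    have ha' : a ≠ 0 := ha
    simp [banditMean, bitPolicy, ha']
  | succ i =>
    cases h : θ i <;> simp only [bitPolicy, Fin.cons_succ, h] at ha <;>
      simp only [banditMean, bitPolicy, Fin.cons_succ, h] <;> split_ifs <;>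
      first | linarith | simp_all

/-- Action 0 loses `δ` when the bit is true, action 1 when it is false, and any other action has
mean 0 and loses at least 1/2 both times. -/
theorem banditMean_separation {T B : ℕ} {δ : ℝ} (h0 : 0 < δ) (h1 : δ ≤ 1 / 2)
    (θ : Fin T → Bool) (i : Fin T) (a : Fin (B + 2)) :
    δ ≤ (banditMean B δ θ (i.succ, bitPolicy B θ i.succ) - banditMean B δ θ (i.succ, a)) +
      (banditMean B δ (flipBit i θ) (i.succ, bitPolicy B (flipBit i θ) i.succ) -
        banditMean B δ (flipBit i θ) (i.succ, a)) := by
  have h10 : (1 : Fin (B + 2)) ≠ 0 := by simp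
  simp only [banditMean, bitPolicy, Fin.cons_succ, flipBit_self]
  rcases eq_or_ne a 0 with rfl | ha0
  · cases θ i <;> simp [h10]
  · rcases eq_or_ne a 1 with rfl | ha1
    · cases θ i <;> simp [h10]
    · cases θ i <;> simp [h10, ha0, ha1] <;> linarith

/-- Both summands equal √(1 - 4δ²) / 2, and √t ≥ t on [0, 1]. -/
theorem one_sub_le_sum_sqrt_bernoulliWeight {δ : ℝ} (h0 : 0 ≤ δ) (h1 : δ ≤ 1 / 2) :
    1 - 4 * δ ^ 2 ≤
      ∑ b, √(bernoulliWeight (1 / 2 + δ) b * bernoulliWeight (1 / 2 - δ) b) := by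
  have h : (1 - 4 * δ ^ 2) / 2 ≤ √((1 / 2 + δ) * (1 / 2 - δ)) :=
    Real.le_sqrt_of_sq_le (by
      have h3 : 0 ≤ 1 - 4 * δ ^ 2 := by nlinarith
      nlinarith [mul_nonneg h3 (sq_nonneg δ)])
  have h2 : (1 - (1 / 2 + δ)) * (1 - (1 / 2 - δ)) = (1 / 2 + δ) * (1 / 2 - δ) := by ring
  simp only [bernoulliWeight, Fintype.sum_bool, if_true, Bool.false_eq_true, if_false, h2]
  linarith

/-- The lower bound from bandit problems whose second action is hard to evaluate. -/
theorem le_minimaxRisk_bandit {T B N : ℕ} (hN : 1 ≤ N)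
    {πstar : CBInstance (T + 1) (B + 2) → Policy (T + 1) (B + 2)}
    (hopt : ∀ I, CBInstance.IsOptimal I (πstar I)) {C : ℝ} (hC : 0 ≤ C) {p q u v δ : ℝ}
    (hp : 0 ≤ p) (hTp : T * p ≤ 1) (hq : 0 ≤ q) (hu : 0 ≤ u) (hv : 0 ≤ v)
    (hsum : q + T * (u + v) = 1) (hqC : 1 - T * p ≤ q * C) (huC : p ≤ u * C) (hvC : p ≤ v * C)
    (hδ0 : 0 < δ) (hδ1 : δ ≤ 1 / 2) (hδ : v * (4 * δ ^ 2) ≤ 1 / (2 * (N : ℝ))) :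
    ((T * p * δ / 16 : ℝ) : EReal) ≤ minimaxRisk πstar C N := by
  have hs := stateWeight_nonneg hp hTp
  have h0 := banditWeight_nonneg (T := T) (B := B) hq hu hv
  have h1 := (sum_banditWeight T B q u v).trans hsum
  have hr := banditMean_mem_Icc (T := T) (B := B) hδ0.le hδ1
  refine le_minimaxRisk_of_flipBit hN hopt (pmfOfReal _ hs (sum_stateWeight T p))
    (fun _ => pmfOfReal _ h0 h1) _ hr (bitPolicy B) (banditMean_lt_bitPolicy hδ0 hδ1)
    (fun θ s => ?_) hp hδ0.le (fun i => ?_) (banditMean_separation hδ0 hδ1) (fun θ i => ?_)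
  · rw [pmfOfReal_apply, pmfOfReal_apply, ← ENNReal.ofReal_mul' hC]
    apply ENNReal.ofReal_le_ofReal
    cases s using Fin.cases with
    | zero => simpa [stateWeight, banditWeight, bitPolicy] using hqC
    | succ i => cases h : θ i <;> simpa [stateWeight, banditWeight, bitPolicy, h]
  · rw [toReal_pmfOfReal_apply]
    simp [stateWeight]
  -- Here `μ` is the same for all `θ`; only the rewards at `(i.succ, 1)`, of mass `v`, depend on bit
  -- `i`.
  · refine le_trans ?_ (one_sub_le_sum_sqrt_sampleWeight _ _ _ _
      (fun x => if x = (i.succ, 1) then 4 * δ ^ 2 else 0) fun x => ?_)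
    · simp only [toReal_pmfOfReal_apply, mul_ite, mul_zero, Finset.sum_ite_eq', Finset.mem_univ,
        if_true]
      have : banditWeight T B q u v (i.succ, 1) = v := by simp [banditWeight]
      rw [this]
      linarith
    · simp only [toReal_pmfOfReal_apply]
      rw [Real.sqrt_mul_self (h0 x)]
      refine mul_le_mul_of_nonneg_left ?_ (h0 x)
      by_cases hx : x = (i.succ, 1)
      · have h2 := one_sub_le_sum_sqrt_bernoulliWeight hδ0.le hδ1
        have h3 : ∀ θ : Fin T → Bool, banditMean B δ θ x = if θ i then 1 / 2 + δ else 1 / 2 - δ :=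
          fun θ => by simp [banditMean, hx]
        rw [if_pos hx, h3, h3, flipBit_self]
        cases θ i
        · simpa [mul_comm] using h2
        · simpa using h2
      · have h2 : banditMean B δ (flipBit i θ) x = banditMean B δ θ x := by
          obtain ⟨s, a⟩ := x
          cases s using Fin.cases with
          | zero => simp [banditMean]
          | succ j =>
            simp only [banditMean, Fin.cons_succ]
            split_ifs with ha hb <;> first | rfl | skip
            all_goals
              have hj : j ≠ i := fun h => hx (by simp [h, hb])
              simp_all [flipBit_of_ne hj]
        rw [if_neg hx, h2, sum_sqrt_bernoulliWeight_self (hr θ x), sub_zero]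

/-! ### Choice of parameters and conclusion -/

/-- The `S / N` part of the lower bound. -/
theorem min_div_le_minimaxRisk {T B N : ℕ} (hT : 1 ≤ T) (hN : 1 ≤ N)
    {πstar : CBInstance (T + 1) (B + 2) → Policy (T + 1) (B + 2)}
    (hopt : ∀ I, CBInstance.IsOptimal I (πstar I)) {C : ℝ} (hC : 1 ≤ C) :
    ((1 / 128 * min 1 (((T : ℝ) + 1) / N) : ℝ) : EReal) ≤ minimaxRisk πstar C N := by
  have hT' : (1 : ℝ) ≤ T := by exact_mod_cast hT
  have hN' : (1 : ℝ) ≤ N := by exact_mod_cast hN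
  refine le_trans ?_ (le_minimaxRisk_expert hN hopt hC (p := 1 / (2 * (N + T))) (by positivity)
    ?_ ?_)
  · rw [EReal.coe_le_coe_iff]
    rcases le_total ((T : ℝ) + 1) N with h | h
    · rw [min_eq_right ((div_le_one (by linarith)).2 h), mul_one_div, div_div, div_mul_div_comm,
        div_le_div_iff₀ (by positivity) (by positivity)]
      nlinarith
    · rw [min_eq_left ((one_le_div (by linarith)).2 h), mul_one_div, div_div,
        div_mul_eq_mul_div, div_le_div_iff₀ (by positivity) (by positivity)]
      nlinarith
  · rw [mul_one_div, div_le_one (by positivity)]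
    linarith
  · apply one_div_le_one_div_of_le <;> linarith

/-- The square root part of the lower bound, in the range where it dominates. -/
theorem min_sqrt_le_minimaxRisk {T B N : ℕ} (hT : 1 ≤ T) (hN : 1 ≤ N)
    {πstar : CBInstance (T + 1) (B + 2) → Policy (T + 1) (B + 2)}
    (hopt : ∀ I, CBInstance.IsOptimal I (πstar I)) {C : ℝ}
    (hC : ((T : ℝ) + 1) / N ≤ C - 1) :
    ((1 / 64 * min 1 √(((T : ℝ) + 1) * (C - 1) / N) : ℝ) : EReal) ≤ minimaxRisk πstar C N := by
  have hT' : (1 : ℝ) ≤ T := by exact_mod_cast hT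
  have hN' : (1 : ℝ) ≤ N := by exact_mod_cast hN
  have hC0 : 0 < C - 1 := lt_of_lt_of_le (by positivity) hC
  have hCpos : 0 < C := by linarith
  -- `m` is the total `ρ`-mass of the hard states. Action 1 and the first state get exactly `ρ / C`;
  -- action 0 gets the remaining `(C - 1) / C`, which must be at least `m / C`.
  obtain ⟨m, hm⟩ : ∃ m, m = min (C - 1) 1 := ⟨_, rfl⟩
  have hm0 : 0 < m := hm ▸ lt_min hC0 one_pos
  have hm1 : m ≤ 1 := hm ▸ min_le_right _ _
  have hmC : m ≤ C - 1 := hm ▸ min_le_left _ _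
  have hmC' : C - 1 ≤ C * m := by
    rcases min_choice (C - 1) 1 with h | h <;> rw [hm, h]
    · nlinarith
    · linarith
  obtain ⟨w, hw⟩ : ∃ w, w = √(((T : ℝ) + 1) * (C - 1) / N) := ⟨_, rfl⟩
  have hw0 : 0 < w := hw ▸ Real.sqrt_pos.2 (by positivity)
  have hw2 : w ^ 2 = ((T : ℝ) + 1) * (C - 1) / N := by
    rw [hw, Real.sq_sqrt (by positivity)]
  -- Needed when the cap `δ = 1/2` is active and `m = C - 1`: then `m * δ` is still of order `w`.
  have hwC : w ≤ C - 1 := by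
    refine hw ▸ Real.sqrt_le_iff.2 ⟨hC0.le, ?_⟩
    rw [mul_div_right_comm, sq]
    exact mul_le_mul_of_nonneg_right hC hC0.le
  have hTm : (T : ℝ) * (m / T) = m := by field_simp
  -- The cap keeps the means in [0, 1]; `w / (4 * m)` makes the gap undetectable and `m * δ` equal
  -- to `w / 4`.
  obtain ⟨δ, hδ⟩ : ∃ δ, δ = min (1 / 2) (w / (4 * m)) := ⟨_, rfl⟩
  have hδ0 : 0 < δ := hδ ▸ lt_min (by norm_num) (by positivity)
  have hδw : δ ≤ w / (4 * m) := hδ ▸ min_le_right _ _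
  refine le_trans ?_ (le_minimaxRisk_bandit hN hopt hCpos.le (p := m / T) (q := (1 - m) / C)
    (u := (C - 1) / (T * C)) (v := m / (T * C)) (δ := δ) (by positivity) (by rwa [hTm])
    (div_nonneg (by linarith) hCpos.le) (by positivity) (by positivity) (by field_simp; ring)
    ?_ ?_ ?_ hδ0 (hδ ▸ min_le_left _ _) ?_)
  · rw [EReal.coe_le_coe_iff, hTm, ← hw]
    have h1 : min 1 w ≤ 4 * (m * δ) := by
      rcases min_choice (1 / 2) (w / (4 * m)) with h | h <;> rw [hδ, h]
      · rcases min_choice (C - 1) 1 with h' | h' <;> rw [hm, h']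
        · exact (min_le_right _ _).trans (by linarith)
        · exact (min_le_left _ _).trans (by norm_num)
      · refine (min_le_right _ _).trans_eq ?_
        field_simp
    linarith
  · rw [hTm, div_mul_cancel₀ _ hCpos.ne']
  · rw [← div_div, div_mul_cancel₀ _ hCpos.ne']
    gcongr
  · rw [← div_div, div_mul_cancel₀ _ hCpos.ne']
  · have h1 : δ ^ 2 ≤ ((T : ℝ) + 1) * (C - 1) / N / (16 * m ^ 2) := by
      calc δ ^ 2 ≤ (w / (4 * m)) ^ 2 := pow_le_pow_left₀ hδ0.le hδw 2
        _ = _ := by rw [div_pow, hw2]; ring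
    calc m / (T * C) * (4 * δ ^ 2)
        ≤ m / (T * C) * (4 * (((T : ℝ) + 1) * (C - 1) / N / (16 * m ^ 2))) := by gcongr
      _ = ((T + 1) * (C - 1)) / (2 * T * (C * m)) * (1 / (2 * (N : ℝ))) := by field_simp; norm_num
      _ ≤ 1 * (1 / (2 * (N : ℝ))) := by
        refine mul_le_mul_of_nonneg_right ((div_le_one (by positivity)).2 ?_) (by positivity)
        exact mul_le_mul (by linarith) hmC' hC0.le (by positivity)
      _ = _ := one_mul _

end OfflineCB

theorem mainTheorem2 :
    ∃ c : ℝ, 0 < c ∧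
      ∀ (S A N : ℕ), 2 ≤ S → 2 ≤ A → 1 ≤ N →
      ∀ πstar : OfflineCB.CBInstance S A → OfflineCB.Policy S A,
        (∀ I : OfflineCB.CBInstance S A, I.IsOptimal (πstar I)) →
      ∀ C : ℝ, 1 ≤ C →
        ((c * min 1 (Real.sqrt ((S : ℝ) * (C - 1) / (N : ℝ)) + (S : ℝ) / (N : ℝ)) : ℝ) : EReal) ≤
          OfflineCB.minimaxRisk πstar C N := by
  -- Half of 1/128, the smaller of the two constants: a sum is at most twice its larger term.
  refine ⟨1 / 256, by norm_num, fun S A N hS hA hN πstar hopt C hC => ?_⟩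
  obtain ⟨T, rfl⟩ : ∃ T, S = T + 1 := ⟨S - 1, by omega⟩
  obtain ⟨B, rfl⟩ : ∃ B, A = B + 2 := ⟨A - 2, by omega⟩
  have hT : 1 ≤ T := by omega
  have hN' : (1 : ℝ) ≤ N := by exact_mod_cast hN
  have hS' : ((T + 1 : ℕ) : ℝ) = T + 1 := by push_cast; rfl
  rw [hS']
  have hmin : ∀ x y : ℝ, 0 ≤ y → x ≤ y → min 1 (x + y) ≤ 2 * min 1 y := fun x y hy hxy => by
    rcases min_choice 1 y with h | h <;> rw [h]
    · exact (min_le_left _ _).trans (by norm_num)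
    · exact (min_le_right _ _).trans (by linarith)
  -- The two terms of the bound are equal at `C - 1 = S/N`; above it the square root dominates,
  -- below it `S/N`.
  rcases le_total (((T : ℝ) + 1) / N) (C - 1) with h | h
  · refine le_trans ?_ (OfflineCB.min_sqrt_le_minimaxRisk hT hN hopt h)
    rw [EReal.coe_le_coe_iff]
    have h1 : ((T : ℝ) + 1) / N ≤ √(((T : ℝ) + 1) * (C - 1) / N) := by
      refine Real.le_sqrt_of_sq_le ?_
      rw [mul_div_right_comm, sq]
      exact mul_le_mul_of_nonneg_left h (by positivity)
    have h2 := hmin _ _ (Real.sqrt_nonneg _) h1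
    rw [add_comm] at h2
    have h3 : 0 ≤ min 1 √(((T : ℝ) + 1) * (C - 1) / N) :=
      le_min zero_le_one (Real.sqrt_nonneg _)
    linarith
  · refine le_trans ?_ (OfflineCB.min_div_le_minimaxRisk hT hN hopt hC)
    rw [EReal.coe_le_coe_iff]
    have h1 : √(((T : ℝ) + 1) * (C - 1) / N) ≤ ((T : ℝ) + 1) / N := by
      refine Real.sqrt_le_iff.2 ⟨by positivity, ?_⟩
      rw [mul_div_right_comm, sq]
      exact mul_le_mul_of_nonneg_left h (by positivity)
    have h2 := hmin _ _ (by positivity) h1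
    linarith
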